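/- Let $d\ge 1$, let $X=\{1,\dots,d\}^{\mathbb N}$ be the full one-sided shift space with left shift $\sigma$, with the metric $d_\theta(x,y)=\theta^{N}$, where $N\ge 1$ is the first index with $x_N\ne y_N$ (and $d_\theta(x,x)=0$), for a fixed $0<\theta<1$. Let $f:X\to\mathbb R$ be strictly positive and Lipschitz for $d_\theta$. Let $\mathcal M$ be the set of $\sigma$-invariant Borel probability measures on $X$, with the weak* topology, $\beta(f)=\sup_{\nu\in\mathcal M}\int f\,d\nu$, and $M_{max}(f)=\{\nu\in\mathcal M:\int f\,d\nu=\beta(f)\}$. For $k:X\to\mathbb R$ write $k^n=k+k\circ\sigma+\dots+k\circ\sigma^{n-1}$, let $\mathrm{Fix}_n=\{x\in X:\sigma^n x=x\}$, and let $P(k)=\lim_{n\to\infty}\frac1n\log\sum_{w\in\{1,\dots,d\}^n}\sup_{x\in[w]}e^{k^n(x)}$ be the topological pressure of a continuous $k$, where $[w]$ is the set of points that start with the word $w$. For all $c>0$ and $0<s<1$ there is a measure $\mu_{c,s}\in\mathcal M$ such that, for every continuous $k:X\to\mathbb R$, $$\int k\,d\mu_{c,s}=\frac{\sum_{n=1}^{\infty}\sum_{x\in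 \mathrm{Fix}_{n}}e^{c\,s\,f^{n}(x)-n\,P(c\,f)}\,\frac{k^{n}(x)}{n}}{\sum_{n=1}^{\infty}\sum_{x\in \mathrm{Fix}_{n}}e^{c\,s\,f^{n}(x)-n\,P(c\,f)}},$$ where both series over $n$ converge and the denominator is positive. Moreover: (1) Every weak* accumulation point of $\mu_{c,s}$, as $c\to\infty$ and $s\to1$ ($s<1$), belongs to $M_{max}(f)$. (2) If $g:X\to\mathbb R$ is continuous and $c_j\to\infty$ and $s_j\to1$ ($s_j<1$) are sequences for which $\lim_{j\to\infty}\int g\,d\mu_{c_j,s_j}$ exists, then this limit equals $\int g\,d\mu$ for some weak* accumulation point $\mu$ of $\mu_{c,s}$, as $c\to\infty$ and $s\to1$. (3) In particular, if $M_{max}(f)$ has exactly one element $\mu_\infty$, then $\lim_{c\to\infty,\,s\to1}\int g\,d\mu_{c,s}=\int g\,d\mu_\infty$ for every continuous $g:X\to\mathbb R$. -/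

import Mathlib

open Set Filter Topology MeasureTheory

namespace ZetaMeasures

/-- The full one-sided Bernoulli space on `d` symbols, with the product topology and the product
(that is, Borel) `σ`-algebra. -/
abbrev Bern (d : ℕ) : Type := ℕ → Fin d

/-- The left shift. -/
def shift {d : ℕ} (x : Bern d) : Bern d := fun i => x (i + 1)

/-- The metric `d_θ`: it is `θ ^ N` if the first coordinate in which `x` and `y` differ is the
`N`-th one (coordinates being numbered from `1`; `PiNat.firstDiff` numbers them from `0`), and `0`
if `x = y`. -/
noncomputable def distTheta {d : ℕ} (θ : ℝ) (x y : Bern d) : ℝ :=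
  open Classical in if x = y then 0 else θ ^ (PiNat.firstDiff x y + 1)

/-- `f` is Lipschitz for the metric `d_θ`. -/
def IsLipschitzTheta {d : ℕ} (θ : ℝ) (f : Bern d → ℝ) : Prop :=
  ∃ C : ℝ, ∀ x y, |f x - f y| ≤ C * distTheta θ x y

/-- The shift-invariant Borel probability measures. -/
def invariantMeasures (d : ℕ) : Set (ProbabilityMeasure (Bern d)) :=
  {ν | MeasurePreserving shift (ν : Measure (Bern d)) (ν : Measure (Bern d))}

/-- `β(f)`, the supremum of `∫ f dν` over the invariant probability measures. -/
noncomputable def maxValue {d : ℕ} (f : Bern d → ℝ) : ℝ :=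
  sSup ((fun ν : ProbabilityMeasure (Bern d) => ∫ x, f x ∂(ν : Measure (Bern d))) ''
    invariantMeasures d)

/-- The set of `f`-maximizing probability measures. -/
def maximizingMeasures {d : ℕ} (f : Bern d → ℝ) : Set (ProbabilityMeasure (Bern d)) :=
  {ν | ν ∈ invariantMeasures d ∧ ∫ x, f x ∂(ν : Measure (Bern d)) = maxValue f}

/-- The cylinder of the points that start with the word `w`. -/
def wordCylinder {d n : ℕ} (w : Fin n → Fin d) : Set (Bern d) :=
  {x | ∀ i : Fin n, x i = w i}

/-- The `n`-th partition function `∑_w sup_{x ∈ [w]} exp (f(x) + ⋯ + f(σ^{n-1} x))`, the sum being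
over the words of length `n`. -/
noncomputable def partitionFunction {d : ℕ} (f : Bern d → ℝ) (n : ℕ) : ℝ :=
  ∑ w : Fin n → Fin d, sSup ((fun x => Real.exp (birkhoffSum shift f n x)) '' wordCylinder w)

/-- The topological pressure of `f`, the exponential growth rate of the partition functions. (For
continuous `f` the sequence is bounded and, by subadditivity, the upper limit is a limit.) -/
noncomputable def pressure {d : ℕ} (f : Bern d → ℝ) : ℝ :=
  limsup (fun n : ℕ => Real.log (partitionFunction f n) / n) atTop

/-- `Fix_n`, the set of solutions of `σ^n x = x`, for `n ≥ 1`. -/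
abbrev Fix (d : ℕ) (n : ℕ+) : Set (Bern d) := Function.ptsOfPeriod shift (n : ℕ)

theorem shift_iterate {d : ℕ} (n : ℕ) (x : Bern d) (i : ℕ) : shift^[n] x i = x (i + n) := by
  induction n generalizing x with
  | zero => rfl
  | succ n ih =>
    rw [Function.iterate_succ_apply, ih]
    rfl

theorem finite_fix (d : ℕ) (n : ℕ+) : Finite (Fix d n) := by
  refine Finite.of_injective (fun (x : Fix d n) (i : Fin (n : ℕ)) => x.1 i) ?_
  intro x y h
  apply Subtype.ext
  have key : ∀ z : Fix d n, ∀ i, z.1 i = z.1 (i % (n : ℕ)) := by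
    intro z i
    have hz : ∀ j, z.1 (j + n) = z.1 j := fun j =>
      (shift_iterate (n : ℕ) z.1 j).symm.trans (congrFun z.2 j)
    exact (Function.Periodic.map_mod_nat hz i).symm
  funext i
  rw [key x, key y]
  exact congrFun h ⟨i % (n : ℕ), Nat.mod_lt _ n.pos⟩

noncomputable instance fintypeFix (d : ℕ) (n : ℕ+) : Fintype (Fix d n) :=
  haveI := finite_fix d n
  Fintype.ofFinite _

/-- The weight `exp (c s f^n(x) - n P(c f))`. -/
noncomputable def weight {d : ℕ} (f : Bern d → ℝ) (c s : ℝ) (n : ℕ+) (x : Bern d) : ℝ :=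
  Real.exp (c * s * birkhoffSum shift f n x - n * pressure (fun y => c * f y))

/-- The measure `∑_{n ≥ 1} ∑_{x ∈ Fix_n} e^{c s f^n(x) - n P(c f)} (1/n) ∑_{i < n} δ_{σ^i x}`. -/
noncomputable def zetaSum {d : ℕ} (f : Bern d → ℝ) (c s : ℝ) : Measure (Bern d) :=
  Measure.sum fun n : ℕ+ => ∑ x : Fix d n, ENNReal.ofReal (weight f c s n x / n) •
    ∑ i ∈ Finset.range n, Measure.dirac (shift^[i] x.1)

/-- The normalization of `zetaSum` to total mass `1`. -/
noncomputable def zetaMeasure {d : ℕ} (f : Bern d → ℝ) (c s : ℝ) : Measure (Bern d) :=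
  (zetaSum f c s Set.univ)⁻¹ • zetaSum f c s

/-- The zeta measure `μ_{c,s}` as a probability measure. The second alternative never occurs in
the range `0 < c`, `0 < s < 1` (for `f` positive and Lipschitz), where `μ_{c,s}` is defined. -/
noncomputable def zetaProb {d : ℕ} [NeZero d] (f : Bern d → ℝ) (c s : ℝ) :
    ProbabilityMeasure (Bern d) :=
  open Classical in
  if h : IsProbabilityMeasure (zetaMeasure f c s) then ⟨zetaMeasure f c s, h⟩ else default

/-- The terms `∑_{x ∈ Fix_n} e^{c s f^n(x) - n P(c f)} k^n(x) / n`. -/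
noncomputable def zetaTerm {d : ℕ} (f : Bern d → ℝ) (c s : ℝ) (k : Bern d → ℝ) (n : ℕ+) : ℝ :=
  ∑ x : Fix d n, weight f c s n x * (birkhoffSum shift k n x.1 / n)

/-- The terms `∑_{x ∈ Fix_n} e^{c s f^n(x) - n P(c f)}`. -/
noncomputable def zetaNormTerm {d : ℕ} (f : Bern d → ℝ) (c s : ℝ) (n : ℕ+) : ℝ :=
  ∑ x : Fix d n, weight f c s n x

/-- The regime `c → ∞`, `s → 1` with `s < 1`, for pairs `(c, s)`. -/
def zeroTempRegime : Filter (ℝ × ℝ) := atTop ×ˢ 𝓝[<] (1 : ℝ)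

/-- `μ` is an accumulation point of `μ_{c,s}`, as `c → ∞` and `s → 1`, in the weak* topology (the
topology of `ProbabilityMeasure`). -/
def IsZetaAccPt {d : ℕ} [NeZero d] (f : Bern d → ℝ) (μ : ProbabilityMeasure (Bern d)) : Prop :=
  MapClusterPt μ zeroTempRegime (fun p : ℝ × ℝ => zetaProb f p.1 p.2)

end ZetaMeasures

namespace ZetaMeasures

variable {d : ℕ}

/-! Write `β` for the maximal integral and `D = C / (1 - θ)`. The crux is that the integral of `f`
against the zeta measures tends to `β` (`HasVariation.tendsto_integral_zetaProb`). Since invariant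
measures form a closed set and integration of a continuous function is weak* continuous, every
accumulation point is then maximizing. The claims on sequences and on uniqueness follow from
compactness of the space of probability measures.

For the crux, fix `ε > 0` and split the periodic points by their average of `f`. Those with average
at least `β - ε` lower the integral by at most `ε`. For the others, `P(c f) ≥ c β` and `s ≥ 1/2`
force a weight of at most `exp (-n c ε / 2)`; there are at most `d ^ n` of them, so for large `c`
their total contribution is of order `exp (-c ε / 2)` (`mul_zetaNormTerm_sub_zetaTerm_le`).

This must be negligible against the normalizing series, so that series may not decay at a fixed
exponential rate in `c`. A single weight suffices for the lower bound: given `η > 0` there is a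
periodic point with `f^n(x) ≥ n β - η`, the error being `η` in total and not per step
(`HasVariation.exists_mem_fix_le_birkhoffSum`). With `P(c f) ≤ c β + log d`, its weight is at least
a constant times `exp (-2 η c)` once `s` is close to `1`. Since `n` depends only on `η`, no relation
between the rates of `c → ∞` and `s → 1` is needed. -/

theorem continuous_shift : Continuous (shift : Bern d → Bern d) :=
  continuous_pi fun i => continuous_apply (i + 1)

/-! ### Lipschitz functions and bounded distortion of Birkhoff sums -/

/-- A form of the Lipschitz condition: `f` varies by at most `C * θ ^ m` on cylinders of
length `m`. -/
def HasVariation (θ C : ℝ) (f : Bern d → ℝ) : Prop :=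
  ∀ (m : ℕ) (x y : Bern d), (∀ i < m, x i = y i) → |f x - f y| ≤ C * θ ^ m

theorem IsLipschitzTheta.exists_hasVariation {θ : ℝ} (hθ0 : 0 < θ) (hθ1 : θ < 1)
    {f : Bern d → ℝ} (hf : IsLipschitzTheta θ f) : ∃ C, 0 ≤ C ∧ HasVariation θ C f := by
  obtain ⟨C, hC⟩ := hf
  -- The given constant can be negative, for instance when `d = 1` and all distances vanish.
  refine ⟨max C 0, le_max_right _ _, fun m x y h => ?_⟩
  refine (hC x y).trans ?_
  unfold distTheta
  split_ifs with hxy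
  · simp only [mul_zero]; positivity
  · have hm : m ≤ PiNat.firstDiff x y := by
      by_contra hlt
      exact PiNat.apply_firstDiff_ne hxy (h _ (not_le.1 hlt))
    exact mul_le_mul (le_max_left _ _)
      (pow_le_pow_of_le_one hθ0.le hθ1.le (by omega)) (by positivity) (le_max_right _ _)

theorem isOpen_agree (m : ℕ) (x : Bern d) : IsOpen {y : Bern d | ∀ i < m, x i = y i} := by
  have : {y : Bern d | ∀ i < m, x i = y i} = ⋂ i ∈ Finset.range m, {y | x i = y i} := by
    ext y; simp
  rw [this]
  refine isOpen_biInter_finset fun i _ => ?_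
  exact (isOpen_discrete {a | x i = a}).preimage (continuous_apply i)

theorem HasVariation.continuous {θ C : ℝ} (hθ0 : 0 < θ) (hθ1 : θ < 1)
    {f : Bern d → ℝ} (hf : HasVariation θ C f) : Continuous f := by
  rw [continuous_iff_continuousAt]
  intro x
  rw [ContinuousAt, Metric.tendsto_nhds]
  intro ε hε
  have ht : Tendsto (fun m : ℕ => C * θ ^ m) atTop (𝓝 0) := by
    simpa using (tendsto_pow_atTop_nhds_zero_of_lt_one hθ0.le hθ1).const_mul C
  obtain ⟨m, hm⟩ := (ht.eventually_lt_const hε).exists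
  filter_upwards [(isOpen_agree m x).mem_nhds (fun _ _ => rfl)] with y hy
  rw [dist_comm, Real.dist_eq]
  exact (hf m x y hy).trans_lt hm

theorem continuous_birkhoffSum {f : Bern d → ℝ} (hf : Continuous f) (n : ℕ) :
    Continuous (birkhoffSum shift f n) := by
  unfold birkhoffSum
  exact continuous_finsetSum _ fun i _ => hf.comp (continuous_shift.iterate i)

theorem birkhoffSum_const_mul (c : ℝ) (f : Bern d → ℝ) (n : ℕ) (x : Bern d) :
    birkhoffSum shift (fun y => c * f y) n x = c * birkhoffSum shift f n x := by
  simp [birkhoffSum, Finset.mul_sum]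

/-- After `i` shifts the points still agree on `n + m - i` symbols, so the errors form a geometric
series whose largest term is of order `θ ^ m`, uniformly in `n`. -/
theorem HasVariation.abs_birkhoffSum_sub_le {θ C : ℝ} (hθ0 : 0 < θ) (hθ1 : θ < 1) (hC : 0 ≤ C)
    {f : Bern d → ℝ} (hf : HasVariation θ C f) (m n : ℕ) (x y : Bern d)
    (h : ∀ i < n + m, x i = y i) :
    |birkhoffSum shift f n x - birkhoffSum shift f n y| ≤ C / (1 - θ) * θ ^ m := by
  have key : ∀ n : ℕ, ∀ x y : Bern d, (∀ i < n + m, x i = y i) →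
      |birkhoffSum shift f n x - birkhoffSum shift f n y| ≤
        C * θ ^ m * ∑ j ∈ Finset.range n, θ ^ j := by
    intro n
    induction n with
    | zero => simp
    | succ n ih =>
      intro x y h
      rw [birkhoffSum_succ', birkhoffSum_succ', Finset.sum_range_succ, mul_add]
      have h1 := ih (shift x) (shift y) fun i hi => h (i + 1) (by omega)
      have h2 := hf (m + n) x y fun i hi => h i (by omega)
      rw [pow_add, ← mul_assoc] at h2
      calc _ = |(f x - f y) + (birkhoffSum shift f n (shift x) -
              birkhoffSum shift f n (shift y))| := by congr 1; ring
        _ ≤ _ := (abs_add_le _ _).trans (by linarith)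
  have hsum : ∑ j ∈ Finset.range n, θ ^ j ≤ (1 - θ)⁻¹ := by
    rw [← tsum_geometric_of_lt_one hθ0.le hθ1]
    exact (summable_geometric_of_lt_one hθ0.le hθ1).sum_le_tsum _ fun _ _ => by positivity
  calc _ ≤ _ := key n x y h
    _ ≤ C * θ ^ m * (1 - θ)⁻¹ := by gcongr
    _ = _ := by ring

/-! ### Periodic points and their orbit measures -/

/-- The periodic point that repeats the first `n` symbols of `x`. -/
def periodize (n : ℕ) (x : Bern d) : Bern d := fun i => x (i % n)

theorem periodize_mem (n : ℕ+) (x : Bern d) : periodize n x ∈ Fix d n := by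
  change shift^[(n : ℕ)] (periodize n x) = periodize n x
  funext i
  rw [shift_iterate]
  simp [periodize]

/-- An orbit that nearly returns after `n` steps is shadowed by a periodic one beyond time `n`; the
extra `m` symbols are what makes the distortion bound small. -/
theorem periodize_apply_of_agree {n m : ℕ} {x : Bern d} (h : ∀ i < m, shift^[n] x i = x i) :
    ∀ i < n + m, periodize n x i = x i := by
  intro i
  induction i using Nat.strong_induction_on with
  | _ i ih =>
    intro hi
    rcases lt_or_ge i n with hin | hin
    · simp [periodize, Nat.mod_eq_of_lt hin]
    · rcases Nat.eq_zero_or_pos n with rfl | hn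
      · simp [periodize]
      have h1 := ih (i - n) (by omega) (by omega)
      have h2 := h (i - n) (by omega)
      rw [shift_iterate, Nat.sub_add_cancel hin] at h2
      rw [h2, ← h1, periodize, periodize, Nat.mod_eq_sub_mod hin]

/-- The sum of the point masses along the first `n` points of the orbit of `x`. -/
noncomputable def orbitMeasure (n : ℕ) (x : Bern d) : Measure (Bern d) :=
  ∑ i ∈ Finset.range n, Measure.dirac (shift^[i] x)

theorem orbitMeasure_univ (n : ℕ) (x : Bern d) : orbitMeasure n x univ = n := by
  simp [orbitMeasure]

instance (n : ℕ) (x : Bern d) : IsFiniteMeasure (orbitMeasure n x) :=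
  ⟨by rw [orbitMeasure_univ]; exact ENNReal.natCast_lt_top n⟩

theorem map_shift_orbitMeasure {n : ℕ+} {x : Bern d} (hx : x ∈ Fix d n) :
    (orbitMeasure n x).map shift = orbitMeasure n x := by
  have hx' : shift^[(n : ℕ)] x = x := hx
  obtain ⟨m, hm⟩ := Nat.exists_eq_succ_of_ne_zero n.ne_zero
  rw [hm] at hx' ⊢
  unfold orbitMeasure
  rw [← Measure.mapₗ_apply_of_measurable continuous_shift.measurable, map_sum]
  simp_rw [Measure.mapₗ_apply_of_measurable continuous_shift.measurable,
    Measure.map_dirac' continuous_shift.measurable, ← Function.iterate_succ_apply']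
  -- The image trades the mass at `x` for one at `σ^n x`, which is `x` again.
  rw [Finset.sum_range_succ, Finset.sum_range_succ', hx']
  rfl

theorem integral_orbitMeasure (n : ℕ) (x : Bern d) (k : Bern d → ℝ) :
    ∫ y, k y ∂(orbitMeasure n x) = birkhoffSum shift k n x := by
  rw [orbitMeasure, integral_finsetSum_measure fun i _ => integrable_dirac (by simp)]
  simp [birkhoffSum]

/-- The invariant probability measure carried by the orbit of a periodic point. -/
noncomputable def periodicMeasure (n : ℕ+) (x : Bern d) : ProbabilityMeasure (Bern d) :=
  ⟨(n : ENNReal)⁻¹ • orbitMeasure n x, ⟨by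
    rw [Measure.smul_apply, orbitMeasure_univ, smul_eq_mul]
    exact ENNReal.inv_mul_cancel (by simp) (by simp)⟩⟩

theorem periodicMeasure_mem {n : ℕ+} {x : Bern d} (hx : x ∈ Fix d n) :
    periodicMeasure n x ∈ invariantMeasures d := by
  refine ⟨continuous_shift.measurable, ?_⟩
  change Measure.map shift ((n : ENNReal)⁻¹ • orbitMeasure n x) = _
  rw [Measure.map_smul, map_shift_orbitMeasure hx]
  rfl

theorem integral_periodicMeasure (n : ℕ+) (x : Bern d) (k : Bern d → ℝ) :
    ∫ y, k y ∂(periodicMeasure n x : Measure (Bern d)) = birkhoffSum shift k n x / n := by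
  change ∫ y, k y ∂((n : ENNReal)⁻¹ • orbitMeasure n x) = _
  rw [integral_smul_measure, integral_orbitMeasure]
  simp [div_eq_inv_mul]

/-! ### Birkhoff sums compared with the maximal integral -/

theorem exists_abs_le {f : Bern d → ℝ} (hf : Continuous f) : ∃ M, ∀ x, |f x| ≤ M := by
  obtain ⟨M, hM⟩ := isCompact_univ.exists_bound_of_continuousOn hf.continuousOn
  exact ⟨M, fun x => hM x (mem_univ x)⟩

theorem integrable_of_continuous {f : Bern d → ℝ} (hf : Continuous f) (μ : Measure (Bern d))
    [IsFiniteMeasure μ] : Integrable f μ := by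
  obtain ⟨M, hM⟩ := exists_abs_le hf
  exact Integrable.of_bound hf.measurable.aestronglyMeasurable M (ae_of_all _ hM)

theorem integral_birkhoffSum {f : Bern d → ℝ} (hf : Continuous f)
    {ν : ProbabilityMeasure (Bern d)} (hν : ν ∈ invariantMeasures d) (n : ℕ) :
    ∫ x, birkhoffSum shift f n x ∂(ν : Measure (Bern d)) =
      n * ∫ x, f x ∂(ν : Measure (Bern d)) := by
  have hν' : MeasurePreserving shift (ν : Measure (Bern d)) (ν : Measure (Bern d)) := hν
  unfold birkhoffSum
  have hint : ∀ i ∈ Finset.range n, Integrable (fun x => f (shift^[i] x)) (ν : Measure (Bern d)) :=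
    fun i _ => integrable_of_continuous (hf.comp (continuous_shift.iterate i)) _
  rw [integral_finsetSum _ hint]
  have : ∀ i, ∫ x, f (shift^[i] x) ∂(ν : Measure (Bern d)) =
      ∫ x, f x ∂(ν : Measure (Bern d)) := by
    intro i
    have h := (hν'.iterate i)
    conv_rhs => rw [← h.map_eq]
    rw [integral_map h.measurable.aemeasurable hf.measurable.aestronglyMeasurable]
  simp [this]

theorem bddAbove_integrals {f : Bern d → ℝ} (hf : Continuous f) :
    BddAbove ((fun ν : ProbabilityMeasure (Bern d) => ∫ x, f x ∂(ν : Measure (Bern d))) ''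
      invariantMeasures d) := by
  obtain ⟨M, hM⟩ := exists_abs_le hf
  refine ⟨M, ?_⟩
  rintro _ ⟨ν, -, rfl⟩
  have := integral_mono (integrable_of_continuous hf (ν : Measure (Bern d)))
    (integrable_const M) fun x => (abs_le.1 (hM x)).2
  simpa using this

theorem integral_le_maxValue {f : Bern d → ℝ} (hf : Continuous f)
    {ν : ProbabilityMeasure (Bern d)} (hν : ν ∈ invariantMeasures d) :
    ∫ x, f x ∂(ν : Measure (Bern d)) ≤ maxValue f :=
  le_csSup (bddAbove_integrals hf) ⟨ν, hν, rfl⟩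

theorem birkhoffSum_le_of_mem_fix {f : Bern d → ℝ} (hf : Continuous f) {n : ℕ+} {x : Bern d}
    (hx : x ∈ Fix d n) : birkhoffSum shift f n x ≤ n * maxValue f := by
  have h := integral_le_maxValue hf (periodicMeasure_mem hx)
  rw [integral_periodicMeasure, div_le_iff₀ (by exact_mod_cast n.pos)] at h
  linarith

/-- The maximum of `f^n` dominates its integral, which is `n ∫ f dν` for every invariant `ν`. -/
theorem exists_le_birkhoffSum [NeZero d] {f : Bern d → ℝ} (hf : Continuous f) (n : ℕ) :
    ∃ x, n * maxValue f ≤ birkhoffSum shift f n x := by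
  obtain ⟨x, -, hx⟩ := isCompact_univ.exists_isMaxOn univ_nonempty
    (continuous_birkhoffSum hf n).continuousOn
  refine ⟨x, ?_⟩
  rcases Nat.eq_zero_or_pos n with rfl | hn
  · simp
  have hn' : (0 : ℝ) < n := by exact_mod_cast hn
  rw [mul_comm, ← le_div_iff₀ hn']
  refine csSup_le ⟨_, _, periodicMeasure_mem (periodize_mem 1 default), rfl⟩ ?_
  rintro _ ⟨ν, hν, rfl⟩
  rw [le_div_iff₀ hn', mul_comm]
  simp only
  rw [← integral_birkhoffSum hf hν]
  have := integral_mono (integrable_of_continuous (continuous_birkhoffSum hf n)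
    (ν : Measure (Bern d))) (integrable_const _) fun y => hx (mem_univ y)
  simpa using this

theorem HasVariation.birkhoffSum_le {θ C : ℝ} (hθ0 : 0 < θ) (hθ1 : θ < 1) (hC : 0 ≤ C)
    {f : Bern d → ℝ} (hf : HasVariation θ C f) (n : ℕ) (x : Bern d) :
    birkhoffSum shift f n x ≤ n * maxValue f + C / (1 - θ) := by
  rcases Nat.eq_zero_or_pos n with rfl | hn
  · have : 0 ≤ C / (1 - θ) := div_nonneg hC (by linarith)
    simpa using this
  have h1 := birkhoffSum_le_of_mem_fix (hf.continuous hθ0 hθ1) (periodize_mem ⟨n, hn⟩ x)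
  -- Any point agrees with its periodization on the first `n` symbols, so `m = 0` already gives an
  -- error bounded in `n`.
  have h2 := hf.abs_birkhoffSum_sub_le hθ0 hθ1 hC 0 n x (periodize n x) fun i hi =>
    (periodize_apply_of_agree (m := 0) (by simp) i hi).symm
  have h3 := (abs_le.1 h2).2
  simp only [PNat.mk_coe, pow_zero, mul_one] at h1 h3
  linarith

theorem maxValue_pos [NeZero d] {f : Bern d → ℝ} (hf : Continuous f) (hpos : ∀ x, 0 < f x) :
    0 < maxValue f := by
  have h := birkhoffSum_le_of_mem_fix hf (periodize_mem 1 (default : Bern d))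
  simp only [PNat.one_coe, birkhoffSum_one, Nat.cast_one, one_mul] at h
  exact (hpos _).trans_le h

/-! ### Partition functions and pressure -/

theorem fix_restrict_injective (n : ℕ+) :
    Function.Injective fun (x : Fix d n) (i : Fin (n : ℕ)) => x.1 i := by
  intro x y h
  apply Subtype.ext
  have key : ∀ z : Fix d n, ∀ i, z.1 i = z.1 (i % (n : ℕ)) := by
    intro z i
    have hz : ∀ j, z.1 (j + n) = z.1 j := fun j =>
      (shift_iterate (n : ℕ) z.1 j).symm.trans (congrFun z.2 j)
    exact (Function.Periodic.map_mod_nat hz i).symm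
  funext i
  rw [key x, key y]
  exact congrFun h ⟨i % (n : ℕ), Nat.mod_lt _ n.pos⟩

theorem card_fix_le (n : ℕ+) : Fintype.card (Fix d n) ≤ d ^ (n : ℕ) := by
  simpa using Fintype.card_le_of_injective _ (fix_restrict_injective (d := d) n)

theorem bddAbove_exp_birkhoffSum {h : Bern d → ℝ} (hh : Continuous h) (n : ℕ)
    (s : Set (Bern d)) : BddAbove ((fun x => Real.exp (birkhoffSum shift h n x)) '' s) :=
  ((isCompact_range (continuous_birkhoffSum hh n).rexp).bddAbove).mono (image_subset_range _ _)

theorem sSup_exp_nonneg (h : Bern d → ℝ) (n : ℕ) (s : Set (Bern d)) :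
    0 ≤ sSup ((fun x => Real.exp (birkhoffSum shift h n x)) '' s) :=
  Real.sSup_nonneg (by rintro _ ⟨x, -, rfl⟩; positivity)

theorem exp_birkhoffSum_le_sSup {h : Bern d → ℝ} (hh : Continuous h) (n : ℕ) (x : Bern d) :
    Real.exp (birkhoffSum shift h n x) ≤ sSup ((fun x => Real.exp (birkhoffSum shift h n x)) ''
      wordCylinder fun i : Fin n => x i) :=
  le_csSup (bddAbove_exp_birkhoffSum hh n _) ⟨x, fun _ => rfl, rfl⟩

theorem exp_birkhoffSum_le_partitionFunction {h : Bern d → ℝ} (hh : Continuous h) (n : ℕ)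
    (x : Bern d) : Real.exp (birkhoffSum shift h n x) ≤ partitionFunction h n :=
  (exp_birkhoffSum_le_sSup hh n x).trans
    (Finset.single_le_sum (f := fun w : Fin n → Fin d =>
      sSup ((fun x => Real.exp (birkhoffSum shift h n x)) '' wordCylinder w))
      (fun _ _ => sSup_exp_nonneg h n _) (Finset.mem_univ _))

theorem partitionFunction_le {h : Bern d → ℝ} {n : ℕ} {b : ℝ}
    (hb : ∀ x, birkhoffSum shift h n x ≤ b) : partitionFunction h n ≤ d ^ n * Real.exp b := by
  unfold partitionFunction
  refine (Finset.sum_le_card_nsmul _ _ (Real.exp b) fun _ _ => ?_).trans ?_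
  · refine Real.sSup_le ?_ (Real.exp_pos b).le
    rintro _ ⟨x, -, rfl⟩
    exact Real.exp_le_exp.2 (hb x)
  · simp

theorem sum_fix_le_partitionFunction {h : Bern d → ℝ} (hh : Continuous h) (n : ℕ+) :
    ∑ x : Fix d n, Real.exp (birkhoffSum shift h n x.1) ≤ partitionFunction h n := by
  classical
  set F : (Fin (n : ℕ) → Fin d) → ℝ := fun w =>
    sSup ((fun x => Real.exp (birkhoffSum shift h n x)) '' wordCylinder w)
  calc _ ≤ ∑ x : Fix d n, F fun i => x.1 i :=
        Finset.sum_le_sum fun x _ => exp_birkhoffSum_le_sSup hh n x.1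
    _ = ∑ w ∈ Finset.univ.image (fun (x : Fix d n) (i : Fin (n : ℕ)) => x.1 i), F w :=
        (Finset.sum_image fun x _ y _ hxy => fix_restrict_injective n hxy).symm
    _ ≤ ∑ w, F w := Finset.sum_le_univ_sum_of_nonneg fun w => sSup_exp_nonneg h n _

theorem le_log_partitionFunction {h : Bern d → ℝ} (hh : Continuous h) (n : ℕ) (x : Bern d) :
    birkhoffSum shift h n x ≤ Real.log (partitionFunction h n) := by
  have := exp_birkhoffSum_le_partitionFunction hh n x
  exact (Real.le_log_iff_exp_le ((Real.exp_pos _).trans_le this)).2 this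

theorem log_partitionFunction_le [NeZero d] {h : Bern d → ℝ} (hh : Continuous h) {n : ℕ} {b : ℝ}
    (hb : ∀ x, birkhoffSum shift h n x ≤ b) :
    Real.log (partitionFunction h n) ≤ n * Real.log d + b := by
  have hd : (0 : ℝ) < d := by exact_mod_cast NeZero.pos d
  have hpos := (Real.exp_pos _).trans_le (exp_birkhoffSum_le_partitionFunction hh n default)
  refine (Real.log_le_log hpos (partitionFunction_le hb)).trans_eq ?_
  rw [Real.log_mul (by positivity) (Real.exp_ne_zero _), Real.log_exp, Real.log_pow]

theorem abs_birkhoffSum_le {h : Bern d → ℝ} {M : ℝ} (hM : ∀ x, |h x| ≤ M) (n : ℕ) (x : Bern d) :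
    |birkhoffSum shift h n x| ≤ n * M := by
  unfold birkhoffSum
  refine (Finset.abs_sum_le_sum_abs _ _).trans ?_
  simpa using Finset.sum_le_sum fun i (_ : i ∈ Finset.range n) => hM (shift^[i] x)

/-- A real `limsup` carries information only for bounded sequences; this bound and the next one
license the order arguments about `pressure`. -/
theorem isBoundedUnder_le_pressure [NeZero d] {h : Bern d → ℝ} (hh : Continuous h) :
    IsBoundedUnder (· ≤ ·) atTop fun n : ℕ => Real.log (partitionFunction h n) / n := by
  obtain ⟨M, hM⟩ := exists_abs_le hh
  refine isBoundedUnder_of_eventually_le (a := Real.log d + M) ?_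
  filter_upwards [eventually_gt_atTop 0] with n hn
  have hn' : (0 : ℝ) < n := by exact_mod_cast hn
  rw [div_le_iff₀ hn']
  have := log_partitionFunction_le hh fun x => (abs_le.1 (abs_birkhoffSum_le hM n x)).2
  linarith

theorem isCoboundedUnder_le_pressure [NeZero d] {h : Bern d → ℝ} (hh : Continuous h) :
    IsCoboundedUnder (· ≤ ·) atTop fun n : ℕ => Real.log (partitionFunction h n) / n := by
  obtain ⟨M, hM⟩ := exists_abs_le hh
  refine IsBoundedUnder.isCoboundedUnder_le (isBoundedUnder_of_eventually_ge (a := -M) ?_)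
  filter_upwards [eventually_gt_atTop 0] with n hn
  have hn' : (0 : ℝ) < n := by exact_mod_cast hn
  rw [le_div_iff₀ hn']
  have h1 := (abs_le.1 (abs_birkhoffSum_le hM n default)).1
  have := le_log_partitionFunction hh n default
  linarith

theorem eventually_partitionFunction_le [NeZero d] {h : Bern d → ℝ} (hh : Continuous h) {b : ℝ}
    (hb : pressure h < b) : ∀ᶠ n : ℕ in atTop, partitionFunction h n ≤ Real.exp (n * b) := by
  filter_upwards [eventually_lt_of_limsup_lt hb (isBoundedUnder_le_pressure hh),
    eventually_gt_atTop 0] with n h1 hn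
  have hn' : (0 : ℝ) < n := by exact_mod_cast hn
  rw [div_lt_iff₀ hn', mul_comm] at h1
  have hpos := (Real.exp_pos _).trans_le (exp_birkhoffSum_le_partitionFunction hh n default)
  exact ((Real.log_lt_iff_lt_exp hpos).1 h1).le

theorem mul_maxValue_le_pressure [NeZero d] {f : Bern d → ℝ} (hf : Continuous f) {c : ℝ}
    (hc : 0 ≤ c) : c * maxValue f ≤ pressure fun x => c * f x := by
  refine le_limsup_of_frequently_le (Eventually.frequently ?_)
    (isBoundedUnder_le_pressure (hf.const_mul c))
  filter_upwards [eventually_gt_atTop 0] with n hn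
  have hn' : (0 : ℝ) < n := by exact_mod_cast hn
  obtain ⟨x, hx⟩ := exists_le_birkhoffSum hf n
  rw [le_div_iff₀ hn']
  have h1 := le_log_partitionFunction (hf.const_mul c) n x
  rw [birkhoffSum_const_mul] at h1
  have h2 := mul_le_mul_of_nonneg_left hx hc
  linarith

/-- Counting words costs at most `log d` per symbol. This entropy term does not grow with `c`, so
the crude bound is enough. -/
theorem HasVariation.pressure_le [NeZero d] {θ C : ℝ} (hθ0 : 0 < θ) (hθ1 : θ < 1) (hC : 0 ≤ C)
    {f : Bern d → ℝ} (hf : HasVariation θ C f) {c : ℝ} (hc : 0 ≤ c) :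
    (pressure fun x => c * f x) ≤ c * maxValue f + Real.log d := by
  have hcont := hf.continuous hθ0 hθ1
  set D := C / (1 - θ)
  have ht : Tendsto (fun n : ℕ => (c * maxValue f + Real.log d) + c * D / n) atTop
      (𝓝 (c * maxValue f + Real.log d)) := by
    simpa using (tendsto_const_div_atTop_nhds_zero_nat (c * D)).const_add
      (c * maxValue f + Real.log d)
  rw [← ht.limsup_eq]
  refine limsup_le_limsup ?_ (isCoboundedUnder_le_pressure (hcont.const_mul c))
    ht.isBoundedUnder_le
  filter_upwards [eventually_gt_atTop 0] with n hn
  have hn' : (0 : ℝ) < n := by exact_mod_cast hn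
  rw [div_le_iff₀ hn', add_mul, div_mul_cancel₀ _ hn'.ne']
  have := log_partitionFunction_le (hcont.const_mul c) (n := n)
    (b := c * (n * maxValue f + D)) fun x => by
      rw [birkhoffSum_const_mul]
      exact mul_le_mul_of_nonneg_left (hf.birkhoffSum_le hθ0 hθ1 hC n x) hc
  linarith

/-! ### Nearly maximal periodic orbits -/

/-- There is a point along whose orbit the Birkhoff sums never fall far below their maximal
growth. -/
theorem HasVariation.exists_forall_le_birkhoffSum [NeZero d] {θ C : ℝ} (hθ0 : 0 < θ)
    (hθ1 : θ < 1) (hC : 0 ≤ C) {f : Bern d → ℝ} (hf : HasVariation θ C f) :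
    ∃ y, ∀ n : ℕ, n * maxValue f - C / (1 - θ) ≤ birkhoffSum shift f n y := by
  have hcont := hf.continuous hθ0 hθ1
  set D := C / (1 - θ)
  let K : ℕ → Set (Bern d) := fun N =>
    ⋂ n ∈ Finset.range (N + 1), {y | n * maxValue f - D ≤ birkhoffSum shift f n y}
  have hK : ∀ N y, y ∈ K N ↔ ∀ n ≤ N, n * maxValue f - D ≤ birkhoffSum shift f n y := by
    intro N y; simp [K]
  have hclosed : ∀ N, IsClosed (K N) := fun N => isClosed_biInter fun n _ =>
    isClosed_le continuous_const (continuous_birkhoffSum hcont n)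
  obtain ⟨y, hy⟩ := IsCompact.nonempty_iInter_of_sequence_nonempty_isCompact_isClosed K
    (fun N y h => (hK N y).2 fun n hn => (hK (N + 1) y).1 h n (by omega))
    (fun N => by
      -- Take `y` with `f^N(y) ≥ N β`. The part from time `n` to `N` contributes at most `(N - n) β
      -- + D`, which leaves at least `n β - D` for the first `n` terms.
      obtain ⟨y, hy⟩ := exists_le_birkhoffSum hcont N
      refine ⟨y, (hK N y).2 fun n hn => ?_⟩
      have h1 := birkhoffSum_add shift f n (N - n) y
      rw [Nat.add_sub_cancel' hn] at h1
      have h2 := hf.birkhoffSum_le hθ0 hθ1 hC (N - n) (shift^[n] y)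
      rw [Nat.cast_sub hn] at h2
      linarith)
    (hclosed 0).isCompact hclosed
  exact ⟨y, fun n => (hK n y).1 (mem_iInter.1 hy n) n le_rfl⟩

/-- Periodic orbits approximate the maximal growth of the Birkhoff sums up to an arbitrarily
small total error. -/
theorem HasVariation.exists_mem_fix_le_birkhoffSum [NeZero d] {θ C : ℝ} (hθ0 : 0 < θ)
    (hθ1 : θ < 1) (hC : 0 ≤ C) {f : Bern d → ℝ} (hf : HasVariation θ C f) {η : ℝ} (hη : 0 < η) :
    ∃ (n : ℕ+) (x : Fix d n), n * maxValue f - η ≤ birkhoffSum shift f n x.1 := by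
  obtain ⟨y, hy⟩ := hf.exists_forall_le_birkhoffSum hθ0 hθ1 hC
  set D := C / (1 - θ) with hD
  -- The deviations `a n` stay in `[-D, D]`, so orbit point and deviation can be made to recur
  -- simultaneously. Between two such times the sum is within `η / 2` of `n β`; closing up that
  -- segment costs less than another `η / 2`.
  let a : ℕ → ℝ := fun n => birkhoffSum shift f n y - n * maxValue f
  have ha : ∀ n, (shift^[n] y, a n) ∈ (univ : Set (Bern d)) ×ˢ Icc (-D) D := by
    intro n
    have h1 := hy n
    have h2 := hf.birkhoffSum_le hθ0 hθ1 hC n y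
    exact ⟨mem_univ _, by simp only [a]; linarith, by simp only [a]; linarith⟩
  obtain ⟨⟨z, b⟩, -, φ, hφ, hlim⟩ := (isCompact_univ.prod isCompact_Icc).tendsto_subseq ha
  have ht : Tendsto (fun m : ℕ => D * θ ^ m) atTop (𝓝 0) := by
    simpa using (tendsto_pow_atTop_nhds_zero_of_lt_one hθ0.le hθ1).const_mul D
  obtain ⟨m, hm⟩ := (ht.eventually_lt_const (half_pos hη)).exists
  have hb := (Prod.tendsto_iff _ _).1 hlim
  have e1 := hb.1.eventually ((isOpen_agree m z).mem_nhds fun _ _ => rfl)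
  have e2 := hb.2.eventually (Metric.ball_mem_nhds b (ε := η / 4) (by positivity))
  obtain ⟨k, hk⟩ := eventually_atTop.1 (e1.and e2)
  obtain ⟨hp1, hp2⟩ := hk k le_rfl
  obtain ⟨hq1, hq2⟩ := hk (k + 1) (Nat.le_succ k)
  have hlt : φ k < φ (k + 1) := hφ (Nat.lt_succ_self k)
  simp only [Function.comp, Real.dist_eq] at hp1 hp2 hq1 hq2
  obtain ⟨n, hn⟩ : ∃ n : ℕ+, φ k + n = φ (k + 1) :=
    ⟨⟨φ (k + 1) - φ k, by omega⟩, by simp only [PNat.mk_coe]; omega⟩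
  set x := shift^[φ k] y with hx
  have hagree : ∀ i < m, shift^[(n : ℕ)] x i = x i := by
    intro i hi
    rw [hx, ← Function.iterate_add_apply, add_comm, hn, ← hq1 i hi]
    exact hp1 i hi
  refine ⟨n, ⟨periodize n x, periodize_mem n x⟩, ?_⟩
  have h1 := hf.abs_birkhoffSum_sub_le hθ0 hθ1 hC m n (periodize n x) x
    (periodize_apply_of_agree hagree)
  have h2 := birkhoffSum_add shift f (φ k) n y
  rw [hn, ← hx] at h2
  have h3 := (abs_le.1 h1).1
  have h4 := (abs_lt.1 hp2).2
  have h5 := (abs_lt.1 hq2).1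
  simp only [a] at h4 h5
  have h6 : (φ (k + 1) : ℝ) = φ k + n := by exact_mod_cast hn.symm
  rw [h6] at h5
  simp only
  linarith

/-! ### Convergence of the series and the zeta measures -/

theorem weight_pos (f : Bern d → ℝ) (c s : ℝ) (n : ℕ+) (x : Bern d) : 0 < weight f c s n x :=
  Real.exp_pos _

theorem zetaNormTerm_nonneg (f : Bern d → ℝ) (c s : ℝ) (n : ℕ+) : 0 ≤ zetaNormTerm f c s n :=
  Finset.sum_nonneg fun _ _ => (weight_pos _ _ _ _ _).le

theorem weight_le_zetaNormTerm (f : Bern d → ℝ) (c s : ℝ) (n : ℕ+) (x : Fix d n) :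
    weight f c s n x ≤ zetaNormTerm f c s n :=
  Finset.single_le_sum (f := fun x : Fix d n => weight f c s n x)
    (fun _ _ => (weight_pos _ _ _ _ _).le) (Finset.mem_univ x)

theorem summable_exp_neg_mul_pnat {b : ℝ} (hb : 0 < b) :
    Summable fun n : ℕ+ => Real.exp (-((n : ℕ) * b)) := by
  have h : Summable fun n : ℕ => Real.exp (-b) ^ n :=
    summable_geometric_of_lt_one (Real.exp_pos _).le (by simpa using hb)
  refine (h.comp_injective PNat.coe_injective).congr fun n => ?_
  simp only [Function.comp, ← Real.exp_nat_mul]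
  congr 1; ring

theorem exists_pos_forall_le [NeZero d] {f : Bern d → ℝ} (hf : Continuous f)
    (hpos : ∀ x, 0 < f x) : ∃ m, 0 < m ∧ ∀ x, m ≤ f x := by
  obtain ⟨x, -, hx⟩ := isCompact_univ.exists_isMinOn univ_nonempty hf.continuousOn
  exact ⟨f x, hpos x, fun y => hx (mem_univ y)⟩

/-- Replacing `c f` by `c s f` lowers the `n`-th Birkhoff sum by at least `n κ`, where `κ = c (1 -
s) min f > 0`; the partition functions exceed `exp (n P(c f))` by at most a factor `exp (n κ / 2)`
eventually. -/
theorem summable_zetaNormTerm [NeZero d] {f : Bern d → ℝ} (hf : Continuous f)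
    (hpos : ∀ x, 0 < f x) {c s : ℝ} (hc : 0 < c) (hs1 : s < 1) :
    Summable (zetaNormTerm f c s) := by
  obtain ⟨m, hm0, hm⟩ := exists_pos_forall_le hf hpos
  set P := pressure fun y => c * f y with hP
  set κ := c * (1 - s) * m with hκ
  have hκ0 : 0 < κ := mul_pos (mul_pos hc (by linarith)) hm0
  have htend : Tendsto (fun n : ℕ+ => (n : ℕ)) cofinite atTop := by
    rw [← Nat.cofinite_eq_atTop]; exact PNat.coe_injective.tendsto_cofinite
  refine Summable.of_norm_bounded_eventually
    (summable_exp_neg_mul_pnat (half_pos hκ0)) ?_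
  filter_upwards [htend.eventually (eventually_partitionFunction_le (hf.const_mul c)
    (b := P + κ / 2) (by linarith))] with n hn
  rw [Real.norm_of_nonneg (zetaNormTerm_nonneg _ _ _ _)]
  calc zetaNormTerm f c s n
      ≤ ∑ x : Fix d n, Real.exp (birkhoffSum shift (fun y => c * f y) n x.1) *
          Real.exp (-(n * (P + κ))) := by
        refine Finset.sum_le_sum fun x _ => ?_
        rw [weight, ← Real.exp_add, birkhoffSum_const_mul]
        refine Real.exp_le_exp.2 ?_
        have h1 : (n : ℝ) * m ≤ birkhoffSum shift f n x.1 := by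
          unfold birkhoffSum
          simpa using Finset.sum_le_sum fun i (_ : i ∈ Finset.range n) => hm (shift^[i] x.1)
        have h2 := mul_le_mul_of_nonneg_left h1 (mul_pos hc (by linarith : 0 < 1 - s)).le
        rw [← hP, hκ]
        linarith
    _ = (∑ x : Fix d n, Real.exp (birkhoffSum shift (fun y => c * f y) n x.1)) *
          Real.exp (-(n * (P + κ))) := by rw [Finset.sum_mul]
    _ ≤ Real.exp (n * (P + κ / 2)) * Real.exp (-(n * (P + κ))) := by
        gcongr
        exact (sum_fix_le_partitionFunction (hf.const_mul c) n).trans hn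
    _ = _ := by rw [← Real.exp_add]; congr 1; ring

theorem summable_zetaTerm {f k : Bern d → ℝ} {c s : ℝ} (hsum : Summable (zetaNormTerm f c s))
    (hk : Continuous k) : Summable (zetaTerm f c s k) := by
  obtain ⟨M, hM⟩ := exists_abs_le hk
  refine Summable.of_norm_bounded (hsum.mul_right M) fun n => ?_
  have hn : (0 : ℝ) < n := by exact_mod_cast n.pos
  rw [Real.norm_eq_abs, zetaTerm, zetaNormTerm, Finset.sum_mul]
  refine (Finset.abs_sum_le_sum_abs _ _).trans (Finset.sum_le_sum fun x _ => ?_)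
  rw [abs_mul, abs_of_pos (weight_pos _ _ _ _ _), abs_div, abs_of_pos hn]
  refine mul_le_mul_of_nonneg_left ?_ (weight_pos _ _ _ _ _).le
  rw [div_le_iff₀ hn, mul_comm]
  exact abs_birkhoffSum_le hM _ _

theorem tsum_zetaNormTerm_pos [NeZero d] {f : Bern d → ℝ} {c s : ℝ}
    (hsum : Summable (zetaNormTerm f c s)) : 0 < ∑' n, zetaNormTerm f c s n :=
  hsum.tsum_pos (zetaNormTerm_nonneg f c s) 1
    ((weight_pos f c s 1 _).trans_le
      (weight_le_zetaNormTerm f c s 1 ⟨_, periodize_mem 1 default⟩))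

/-- The contribution of the points of period `n` to `zetaSum`. -/
noncomputable def zetaSummand (f : Bern d → ℝ) (c s : ℝ) (n : ℕ+) : Measure (Bern d) :=
  ∑ x : Fix d n, ENNReal.ofReal (weight f c s n x / n) • orbitMeasure n x.1

theorem zetaSum_eq (f : Bern d → ℝ) (c s : ℝ) :
    zetaSum f c s = Measure.sum (zetaSummand f c s) := rfl

theorem zetaSummand_univ (f : Bern d → ℝ) (c s : ℝ) (n : ℕ+) :
    zetaSummand f c s n univ = ENNReal.ofReal (zetaNormTerm f c s n) := by
  have hn : (0 : ℝ) < n := by exact_mod_cast n.pos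
  rw [zetaSummand, zetaNormTerm, ENNReal.ofReal_sum_of_nonneg fun _ _ => (weight_pos _ _ _ _ _).le,
    Measure.finsetSum_apply]
  refine Finset.sum_congr rfl fun x _ => ?_
  rw [Measure.smul_apply, orbitMeasure_univ, smul_eq_mul, ← ENNReal.ofReal_natCast,
    ← ENNReal.ofReal_mul (div_pos (weight_pos _ _ _ _ _) hn).le, div_mul_cancel₀ _ hn.ne']

theorem integral_zetaSummand {f k : Bern d → ℝ} (c s : ℝ) (hk : Continuous k) (n : ℕ+) :
    ∫ x, k x ∂(zetaSummand f c s n) = zetaTerm f c s k n := by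
  have hn : (0 : ℝ) < n := by exact_mod_cast n.pos
  rw [zetaSummand, integral_finsetSum_measure fun x _ =>
    (integrable_of_continuous hk _).smul_measure ENNReal.ofReal_ne_top, zetaTerm]
  refine Finset.sum_congr rfl fun x _ => ?_
  rw [integral_smul_measure, integral_orbitMeasure,
    ENNReal.toReal_ofReal (div_pos (weight_pos _ _ _ _ _) hn).le, smul_eq_mul]
  ring

theorem map_shift_zetaSum (f : Bern d → ℝ) (c s : ℝ) :
    (zetaSum f c s).map shift = zetaSum f c s := by
  have hmeas : Measurable (shift : Bern d → Bern d) := continuous_shift.measurable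
  rw [zetaSum_eq, Measure.map_sum hmeas.aemeasurable]
  congr 1
  funext n
  rw [zetaSummand, ← Measure.mapₗ_apply_of_measurable hmeas, map_sum]
  refine Finset.sum_congr rfl fun x _ => ?_
  rw [Measure.mapₗ_apply_of_measurable hmeas, Measure.map_smul, map_shift_orbitMeasure x.2]

theorem zetaSum_univ {f : Bern d → ℝ} {c s : ℝ} (hsum : Summable (zetaNormTerm f c s)) :
    zetaSum f c s univ = ENNReal.ofReal (∑' n, zetaNormTerm f c s n) := by
  rw [zetaSum_eq, Measure.sum_apply _ MeasurableSet.univ]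
  simp_rw [zetaSummand_univ]
  exact (ENNReal.ofReal_tsum_of_nonneg (zetaNormTerm_nonneg f c s) hsum).symm

theorem isProbabilityMeasure_zetaMeasure [NeZero d] {f : Bern d → ℝ} {c s : ℝ}
    (hsum : Summable (zetaNormTerm f c s)) : IsProbabilityMeasure (zetaMeasure f c s) := by
  refine ⟨?_⟩
  rw [zetaMeasure, Measure.smul_apply, zetaSum_univ hsum, smul_eq_mul]
  exact ENNReal.inv_mul_cancel (ENNReal.ofReal_pos.2 (tsum_zetaNormTerm_pos hsum)).ne'
    ENNReal.ofReal_ne_top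

theorem coe_zetaProb [NeZero d] {f : Bern d → ℝ} {c s : ℝ}
    (hsum : Summable (zetaNormTerm f c s)) :
    (zetaProb f c s : Measure (Bern d)) = zetaMeasure f c s := by
  have h : zetaProb f c s = ⟨zetaMeasure f c s, isProbabilityMeasure_zetaMeasure hsum⟩ :=
    dif_pos (isProbabilityMeasure_zetaMeasure hsum)
  rw [h]
  rfl

theorem zetaProb_mem_invariantMeasures [NeZero d] {f : Bern d → ℝ} {c s : ℝ}
    (hsum : Summable (zetaNormTerm f c s)) : zetaProb f c s ∈ invariantMeasures d := by
  refine ⟨continuous_shift.measurable, ?_⟩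
  rw [coe_zetaProb hsum, zetaMeasure, Measure.map_smul, map_shift_zetaSum]

theorem integral_zetaProb [NeZero d] {f k : Bern d → ℝ} {c s : ℝ}
    (hsum : Summable (zetaNormTerm f c s)) (hk : Continuous k) :
    ∫ x, k x ∂(zetaProb f c s : Measure (Bern d)) =
      (∑' n, zetaTerm f c s k n) / ∑' n, zetaNormTerm f c s n := by
  have hfin : IsFiniteMeasure (zetaSum f c s) :=
    ⟨by rw [zetaSum_univ hsum]; exact ENNReal.ofReal_lt_top⟩
  have hint : ∫ x, k x ∂(zetaSum f c s) = ∑' n, zetaTerm f c s k n := by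
    have h := integrable_of_continuous hk (zetaSum f c s)
    rw [zetaSum_eq] at h ⊢
    rw [integral_sum_measure h]
    simp_rw [integral_zetaSummand c s hk]
  rw [coe_zetaProb hsum, zetaMeasure, integral_smul_measure, hint, zetaSum_univ hsum,
    ENNReal.toReal_inv, ENNReal.toReal_ofReal (tsum_zetaNormTerm_pos hsum).le, smul_eq_mul,
    inv_mul_eq_div]

/-! ### Convergence of the integrals of `f` -/

theorem mul_zetaNormTerm_sub_zetaTerm_le [NeZero d] {f : Bern d → ℝ} (hf : Continuous f)
    (hpos : ∀ x, 0 < f x) {c s ε : ℝ} (hc : 0 < c) (hs : 1 / 2 ≤ s) (hs1 : s < 1) (hε : 0 < ε)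
    (n : ℕ+) :
    maxValue f * zetaNormTerm f c s n - zetaTerm f c s f n ≤
      ε * zetaNormTerm f c s n + maxValue f * (d * Real.exp (-(c * ε / 2))) ^ (n : ℕ) := by
  have hn : (0 : ℝ) < n := by exact_mod_cast n.pos
  have hβ := maxValue_pos hf hpos
  set β := maxValue f
  have hP := mul_maxValue_le_pressure hf hc.le
  have hterm : ∀ x : Fix d n, weight f c s n x * (β - birkhoffSum shift f n x.1 / n) ≤
      ε * weight f c s n x + β * Real.exp (-(c * ε / 2)) ^ (n : ℕ) := by
    intro x
    have hw := weight_pos f c s n x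
    rcases le_or_gt (β - birkhoffSum shift f n x.1 / n) ε with h | h
    · have h1 := mul_le_mul_of_nonneg_left h hw.le
      have h2 : 0 ≤ β * Real.exp (-(c * ε / 2)) ^ (n : ℕ) := by positivity
      linarith
    · have h0 : 0 ≤ birkhoffSum shift f n x.1 / n :=
        div_nonneg (Finset.sum_nonneg fun _ _ => (hpos _).le) hn.le
      have h1 : weight f c s n x ≤ Real.exp (-(c * ε / 2)) ^ (n : ℕ) := by
        rw [weight, ← Real.exp_nat_mul]
        refine Real.exp_le_exp.2 ?_
        have h2 : birkhoffSum shift f n x.1 ≤ n * (β - ε) := by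
          rw [mul_comm, ← div_le_iff₀ hn]; linarith
        have h3 := mul_le_mul_of_nonneg_left h2 (by positivity : 0 ≤ c * s)
        have h4 := mul_le_mul_of_nonneg_left hP hn.le
        -- The exponent is at most `-n c β (1 - s) - n c s ε`; drop the first term and use `s ≥ 1/2`
        -- in the second.
        have h5 : 0 ≤ (n * c * β) * (1 - s) := mul_nonneg (by positivity) (by linarith)
        have h6 : 0 ≤ (n * c * ε) * (s - 1 / 2) := mul_nonneg (by positivity) (by linarith)
        linarith
      have h2 := mul_le_mul_of_nonneg_left (by linarith : β - birkhoffSum shift f n x.1 / n ≤ β)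
        hw.le
      have h3 := mul_le_mul_of_nonneg_left h1 hβ.le
      have h4 := mul_pos hε hw
      linarith
  have hcard : (Fintype.card (Fix d n) : ℝ) ≤ (d : ℝ) ^ (n : ℕ) := by
    exact_mod_cast card_fix_le n
  calc maxValue f * zetaNormTerm f c s n - zetaTerm f c s f n
      = ∑ x : Fix d n, weight f c s n x * (β - birkhoffSum shift f n x.1 / n) := by
        rw [zetaNormTerm, zetaTerm, Finset.mul_sum, ← Finset.sum_sub_distrib]
        exact Finset.sum_congr rfl fun x _ => by ring
    _ ≤ ∑ x : Fix d n, (ε * weight f c s n x + β * Real.exp (-(c * ε / 2)) ^ (n : ℕ)) :=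
        Finset.sum_le_sum fun x _ => hterm x
    _ = ε * zetaNormTerm f c s n +
          Fintype.card (Fix d n) * (β * Real.exp (-(c * ε / 2)) ^ (n : ℕ)) := by
        rw [Finset.sum_add_distrib, zetaNormTerm, Finset.mul_sum]
        simp
    _ ≤ ε * zetaNormTerm f c s n + (d : ℝ) ^ (n : ℕ) * (β * Real.exp (-(c * ε / 2)) ^ (n : ℕ)) := by
        gcongr
    _ = _ := by rw [mul_pow]; ring

theorem tsum_pnat_pow_le {r : ℝ} (hr0 : 0 ≤ r) (hr : r ≤ 1 / 2) :
    Summable (fun n : ℕ+ => r ^ (n : ℕ)) ∧ ∑' n : ℕ+, r ^ (n : ℕ) ≤ 2 * r := by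
  have hr1 : r < 1 := by linarith
  have hs := summable_geometric_of_lt_one hr0 hr1
  refine ⟨hs.comp_injective PNat.coe_injective, ?_⟩
  rw [tsum_pnat_eq_tsum_succ (f := fun n => r ^ n)]
  simp_rw [pow_succ]
  rw [tsum_mul_right, tsum_geometric_of_lt_one hr0 hr1]
  refine mul_le_mul_of_nonneg_right ?_ hr0
  rw [inv_le_comm₀ (by linarith) (by norm_num)]
  linarith

theorem maxValue_sub_integral_zetaProb_le [NeZero d] {f : Bern d → ℝ} (hf : Continuous f)
    (hpos : ∀ x, 0 < f x) {c s ε : ℝ} (hc : 0 < c) (hs : 1 / 2 ≤ s) (hs1 : s < 1) (hε : 0 < ε)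
    (hr : d * Real.exp (-(c * ε / 2)) ≤ 1 / 2) :
    maxValue f - ∫ x, f x ∂(zetaProb f c s : Measure (Bern d)) ≤
      ε + 2 * maxValue f * (d * Real.exp (-(c * ε / 2))) / ∑' n, zetaNormTerm f c s n := by
  have hsum := summable_zetaNormTerm hf hpos hc hs1
  have hT := tsum_zetaNormTerm_pos hsum
  have hβ := maxValue_pos hf hpos
  have hz := summable_zetaTerm hsum hf
  obtain ⟨hg, hg2⟩ := tsum_pnat_pow_le (by positivity) hr
  set r := d * Real.exp (-(c * ε / 2))
  have h := Summable.tsum_le_tsum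
    (fun n => mul_zetaNormTerm_sub_zetaTerm_le hf hpos hc hs hs1 hε n)
    ((hsum.mul_left (maxValue f)).sub hz)
    ((hsum.mul_left ε).add (hg.mul_left (maxValue f)))
  rw [(hsum.mul_left (maxValue f)).tsum_sub hz,
    (hsum.mul_left ε).tsum_add (hg.mul_left (maxValue f)), tsum_mul_left, tsum_mul_left,
    tsum_mul_left] at h
  have h2 := mul_le_mul_of_nonneg_left hg2 hβ.le
  rw [integral_zetaProb hsum hf]
  set T := ∑' n, zetaNormTerm f c s n
  calc _ = (maxValue f * T - ∑' n, zetaTerm f c s f n) / T := by field_simp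
    _ ≤ (ε * T + 2 * maxValue f * r) / T := by
        gcongr
        linarith
    _ = _ := by field_simp

theorem HasVariation.exists_le_tsum_zetaNormTerm [NeZero d] {θ C : ℝ} (hθ0 : 0 < θ)
    (hθ1 : θ < 1) (hC : 0 ≤ C) {f : Bern d → ℝ} (hf : HasVariation θ C f)
    (hpos : ∀ x, 0 < f x) {η : ℝ} (hη : 0 < η) :
    ∃ a > 0, ∃ s₀ < 1, ∀ c s : ℝ, 0 < c → 0 < s → s₀ < s → s < 1 →
      a * Real.exp (-(2 * η * c)) ≤ ∑' n, zetaNormTerm f c s n := by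
  have hcont := hf.continuous hθ0 hθ1
  have hβ := maxValue_pos hcont hpos
  obtain ⟨n, x, hx⟩ := hf.exists_mem_fix_le_birkhoffSum hθ0 hθ1 hC hη
  have hn : (0 : ℝ) < n := by exact_mod_cast n.pos
  set β := maxValue f
  -- The threshold for `s` ensures `(1 - s) n β ≤ η`, so replacing `c` by `c s` costs at most one
  -- more `c η` in the exponent. The constant pays for the `log d` in the pressure bound.
  refine ⟨Real.exp (-(n * Real.log d)), Real.exp_pos _, 1 - η / (n * β),
    by have : 0 < η / (n * β) := by positivity
       linarith, fun c s hc hs hs0 hs1 => ?_⟩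
  have hsum := summable_zetaNormTerm hcont hpos hc hs1
  refine le_trans ?_ ((weight_le_zetaNormTerm f c s n x).trans
    (hsum.le_tsum n fun _ _ => zetaNormTerm_nonneg _ _ _ _))
  rw [weight, ← Real.exp_add]
  refine Real.exp_le_exp.2 ?_
  have h1 := mul_le_mul_of_nonneg_left (hf.pressure_le hθ0 hθ1 hC hc.le) hn.le
  have h2 := mul_le_mul_of_nonneg_left hx (mul_pos hc hs).le
  have h3 : (1 - s) * (n * β) ≤ η := by
    rw [← le_div_iff₀ (by positivity)]; linarith
  have h4 := mul_le_mul_of_nonneg_left h3 hc.le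
  have h5 : 0 ≤ c * η * (1 - s) := mul_nonneg (by positivity) (by linarith)
  linarith

theorem eventually_zeroTempRegime {s₀ : ℝ} (h₀ : s₀ < 1) :
    ∀ᶠ p in zeroTempRegime, 0 < p.1 ∧ s₀ < p.2 ∧ p.2 < 1 := by
  have h : ∀ᶠ s in 𝓝[<] (1 : ℝ), s₀ < s ∧ s < 1 := Ioo_mem_nhdsLT h₀
  exact (eventually_gt_atTop (0 : ℝ)).prod_mk h

/-- The integrals of `f` with respect to the zeta measures converge to the maximal value. -/
theorem HasVariation.tendsto_integral_zetaProb [NeZero d] {θ C : ℝ} (hθ0 : 0 < θ)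
    (hθ1 : θ < 1) (hC : 0 ≤ C) {f : Bern d → ℝ} (hf : HasVariation θ C f)
    (hpos : ∀ x, 0 < f x) :
    Tendsto (fun p : ℝ × ℝ => ∫ x, f x ∂(zetaProb f p.1 p.2 : Measure (Bern d)))
      zeroTempRegime (𝓝 (maxValue f)) := by
  have hcont := hf.continuous hθ0 hθ1
  have hβ := maxValue_pos hcont hpos
  rw [Metric.tendsto_nhds]
  intro δ hδ
  set ε := δ / 2 with hεδ
  have hε : 0 < ε := half_pos hδ
  -- With `η = ε / 8` the denominator decays no faster than `exp (-c ε / 4)`, against `exp (-c ε /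
  -- 2)` in the numerator.
  obtain ⟨a, ha, s₀, hs₀, hT⟩ :=
    hf.exists_le_tsum_zetaNormTerm hθ0 hθ1 hC hpos (η := ε / 8) (by positivity)
  have hexp : ∀ {t : ℝ}, 0 < t → Tendsto (fun p : ℝ × ℝ => Real.exp (-(p.1 * t)))
      zeroTempRegime (𝓝 0) := fun ht =>
    Real.tendsto_exp_neg_atTop_nhds_zero.comp (tendsto_fst.atTop_mul_const ht)
  have h1 := ((hexp (half_pos hε)).const_mul (d : ℝ)).eventually_lt_const
    (u := 1 / 2) (by norm_num)
  have h2 := ((hexp (t := ε / 4) (by positivity)).const_mul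
    (2 * maxValue f * d / a)).eventually_lt_const (u := ε) (by simpa using hε)
  filter_upwards [h1, h2, eventually_zeroTempRegime hs₀,
    eventually_zeroTempRegime (s₀ := 1 / 2) (by norm_num)] with p hp1 hp2 hp3 hp4
  obtain ⟨hc, hs0, hs1⟩ := hp3
  have hs2 := hp4.2.1
  have hsum := summable_zetaNormTerm hcont hpos hc hs1
  have hle := integral_le_maxValue hcont (zetaProb_mem_invariantMeasures hsum)
  rw [← mul_div_assoc] at hp1
  have hub := maxValue_sub_integral_zetaProb_le hcont hpos hc hs2.le hs1 hε hp1.le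
  have hlow := hT p.1 p.2 hc (by linarith) hs0 hs1
  have hq : 2 * maxValue f * (d * Real.exp (-(p.1 * ε / 2))) / ∑' n, zetaNormTerm f p.1 p.2 n ≤
      2 * maxValue f * d / a * Real.exp (-(p.1 * (ε / 4))) := by
    have hsplit : Real.exp (-(p.1 * ε / 2)) =
        Real.exp (-(p.1 * (ε / 4))) * Real.exp (-(2 * (ε / 8) * p.1)) := by
      rw [← Real.exp_add]; congr 1; ring
    calc _ ≤ 2 * maxValue f * (d * Real.exp (-(p.1 * ε / 2))) /
          (a * Real.exp (-(2 * (ε / 8) * p.1))) := by gcongr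
      _ = _ := by
        rw [hsplit]
        field_simp
  rw [Real.dist_eq, abs_sub_comm, abs_of_nonneg (by linarith)]
  linarith

/-! ### Accumulation points -/

theorem continuous_integral {g : Bern d → ℝ} (hg : Continuous g) :
    Continuous fun ν : ProbabilityMeasure (Bern d) => ∫ x, g x ∂(ν : Measure (Bern d)) :=
  ProbabilityMeasure.continuous_integral_continuousMap (⟨g, hg⟩ : C(Bern d, ℝ))

/-- Invariance is a fixed-point equation for the push-forward, which is weak* continuous because the
shift is continuous. -/
theorem isClosed_invariantMeasures : IsClosed (invariantMeasures d) := by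
  have h : invariantMeasures d =
      {ν | ν.map continuous_shift.measurable.aemeasurable = ν} := by
    ext ν
    refine ⟨fun hν => Subtype.ext hν.map_eq, fun hν => ⟨continuous_shift.measurable, ?_⟩⟩
    exact congrArg (fun ρ : ProbabilityMeasure (Bern d) => (ρ : Measure (Bern d))) hν
  rw [h]
  exact isClosed_eq (ProbabilityMeasure.continuous_map continuous_shift) continuous_id

theorem eq_of_mapClusterPt_of_tendsto {α X : Type*} [TopologicalSpace X] [T2Space X]
    {l : Filter α} {u : α → X} {a b : X} (ha : MapClusterPt a l u) (hb : Tendsto u l (𝓝 b)) :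
    a = b :=
  eq_of_nhds_neBot (ha.clusterPt.mono hb)

theorem HasVariation.mem_maximizingMeasures [NeZero d] {θ C : ℝ} (hθ0 : 0 < θ)
    (hθ1 : θ < 1) (hC : 0 ≤ C) {f : Bern d → ℝ} (hf : HasVariation θ C f)
    (hpos : ∀ x, 0 < f x) {μ : ProbabilityMeasure (Bern d)} (hμ : IsZetaAccPt f μ) :
    μ ∈ maximizingMeasures f := by
  have hcont := hf.continuous hθ0 hθ1
  have h := MapClusterPt.continuousAt_comp (continuous_integral hcont).continuousAt hμ
  refine ⟨isClosed_invariantMeasures.mem_of_mapClusterPt hμ ?_,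
    eq_of_mapClusterPt_of_tendsto h (hf.tendsto_integral_zetaProb hθ0 hθ1 hC hpos)⟩
  filter_upwards [eventually_zeroTempRegime (s₀ := 0) (by norm_num)] with p hp
  exact zetaProb_mem_invariantMeasures (summable_zetaNormTerm hcont hpos hp.1 hp.2.2)

end ZetaMeasures

theorem theorem3 {d : ℕ} [NeZero d] (θ : ℝ) (hθ0 : 0 < θ) (hθ1 : θ < 1)
    (f : ZetaMeasures.Bern d → ℝ) (hf : ZetaMeasures.IsLipschitzTheta θ f)
    (hpos : ∀ x, 0 < f x) :
    -- the measures `μ_{c,s}` are invariant probabilities, given by the well-defined quotient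
    (∀ c s : ℝ, 0 < c → 0 < s → s < 1 →
      ZetaMeasures.zetaProb f c s ∈ ZetaMeasures.invariantMeasures d ∧
      Summable (ZetaMeasures.zetaNormTerm f c s) ∧
      0 < ∑' n, ZetaMeasures.zetaNormTerm f c s n ∧
      ∀ k : ZetaMeasures.Bern d → ℝ, Continuous k →
        Summable (ZetaMeasures.zetaTerm f c s k) ∧
        ∫ x, k x ∂(ZetaMeasures.zetaProb f c s : Measure (ZetaMeasures.Bern d)) =
          (∑' n, ZetaMeasures.zetaTerm f c s k n) / ∑' n, ZetaMeasures.zetaNormTerm f c s n) ∧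
    -- accumulation points are maximizing
    (∀ μ : ProbabilityMeasure (ZetaMeasures.Bern d), ZetaMeasures.IsZetaAccPt f μ →
      μ ∈ ZetaMeasures.maximizingMeasures f) ∧
    -- limits of integrals along sequences are integrals for accumulation points
    (∀ g : ZetaMeasures.Bern d → ℝ, Continuous g → ∀ (c s : ℕ → ℝ) (l : ℝ),
      Tendsto c atTop atTop → Tendsto s atTop (𝓝[<] 1) →
      Tendsto (fun j => ∫ x, g x
        ∂(ZetaMeasures.zetaProb f (c j) (s j) : Measure (ZetaMeasures.Bern d))) atTop (𝓝 l) →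
      ∃ μ : ProbabilityMeasure (ZetaMeasures.Bern d), ZetaMeasures.IsZetaAccPt f μ ∧
        l = ∫ x, g x ∂(μ : Measure (ZetaMeasures.Bern d))) ∧
    -- convergence if the maximizing measure is unique
    (∀ μinf : ProbabilityMeasure (ZetaMeasures.Bern d),
      ZetaMeasures.maximizingMeasures f = {μinf} →
      ∀ g : ZetaMeasures.Bern d → ℝ, Continuous g →
        Tendsto (fun p : ℝ × ℝ => ∫ x, g x
          ∂(ZetaMeasures.zetaProb f p.1 p.2 : Measure (ZetaMeasures.Bern d)))
          ZetaMeasures.zeroTempRegime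
          (𝓝 (∫ x, g x ∂(μinf : Measure (ZetaMeasures.Bern d))))) := by
  obtain ⟨C, hC, hv⟩ := hf.exists_hasVariation hθ0 hθ1
  have hcont := hv.continuous hθ0 hθ1
  refine ⟨fun c s hc _ hs1 => ?_, fun μ hμ => hv.mem_maximizingMeasures hθ0 hθ1 hC hpos hμ,
    fun g hg c s l hc hs hl => ?_, fun μinf huniq g hg => ?_⟩
  · have hsum := ZetaMeasures.summable_zetaNormTerm hcont hpos hc hs1
    exact ⟨ZetaMeasures.zetaProb_mem_invariantMeasures hsum, hsum,
      ZetaMeasures.tsum_zetaNormTerm_pos hsum, fun k hk =>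
        ⟨ZetaMeasures.summable_zetaTerm hsum hk, ZetaMeasures.integral_zetaProb hsum hk⟩⟩
  -- Compactness gives a cluster point along the sequence, hence one in the two-parameter regime;
  -- the convergent integrals can only cluster at `l`.
  · obtain ⟨μ, -, hμ⟩ := isCompact_univ.exists_mapClusterPt (f := atTop)
      (u := fun j => ZetaMeasures.zetaProb f (c j) (s j)) (by simp)
    exact ⟨μ, MapClusterPt.of_comp (hc.prodMk hs) hμ,
      (ZetaMeasures.eq_of_mapClusterPt_of_tendsto (MapClusterPt.continuousAt_comp
        (ZetaMeasures.continuous_integral hg).continuousAt hμ) hl).symm⟩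
  · have hlim : Tendsto (fun p : ℝ × ℝ => ZetaMeasures.zetaProb f p.1 p.2)
        ZetaMeasures.zeroTempRegime (𝓝 μinf) :=
      -- In a compact space, having only one possible cluster point forces convergence.
      tendsto_nhds_of_unique_mapClusterPt fun μ hμ => by
        have h := hv.mem_maximizingMeasures hθ0 hθ1 hC hpos hμ
        rwa [huniq] at h
    exact ((ZetaMeasures.continuous_integral hg).tendsto μinf).comp hlim
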